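/- On Euclidean $\mathbb{R}^7$ let $\varphi_0$ be the standard (torsion-free) $\mathrm{G}_2$-structure and $\psi_0=\star\varphi_0$. Let $a,f:\mathbb{R}\to\mathbb{R}$ be smooth, $a$ odd, $f$ even, with $f^2+a^2=1$. With $r=|x|$, let $X=a(r)\frac{\partial}{\partial r}$, regard $f=f(r)$ as a function on $\mathbb{R}^7$, and let $$\varphi=(f^2-|X|^2)\,\varphi_0-2f\,X\lrcorner\psi_0+2X^\flat\wedge(X\lrcorner\varphi_0)$$ be the corresponding $\mathrm{G}_2$-structure isometric to $\varphi_0$. Let $\psi=\star\varphi$, let $T_{pq}=\tfrac1{24}\nabla_p\varphi_{ijk}\,\psi_{qijk}$ be the torsion tensor of $\varphi$, and write $(\operatorname{div}T)_q=\nabla_pT_{pq}$ and $(Y\lrcorner T)_q=Y_pT_{pq}$ (repeated indices are summed, in an orthonormal frame). Let $c\in\mathbb{R}$. (a) The soliton equation $\operatorname{div}T=c\,r\frac{\partial}{\partial r}\lrcorner T$ holds on $\mathbb{R}^7$ if and only if $$\frac1r(af''-a''f)+\frac6{r^2}(af'-a'f)+\frac6{r^3}af=-c\,\frac{a'}{f}$$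 at every $r>0$ with $f(r)\neq0$. Moreover, for each point $x\ne0$ with $f(|x|)\ne0$, the soliton equation holds at $x$ if and only if the ODE holds at $r=|x|$. (b) Suppose $u:\mathbb{R}\to\mathbb{R}$ is smooth with $a=\sin(\tfrac12u)$ and $f=\cos(\tfrac12u)$. Then the soliton equation holds on $\mathbb{R}^7$ if and only if $$r^2u''+(6-cr^2)\,r\,u'-6\sin u=0$$ at every $r>0$. Moreover, for each point $x\neq0$, the soliton equation holds at $x$ if and only if this ODE holds at $r=|x|$. -/

import Mathlib

open scoped ContDiff

noncomputable section

namespace IsometricSoliton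

/-- Euclidean `ℝ⁷`. Tensors on it are given by their components in the global orthonormal frame
`∂/∂x⁰, …, ∂/∂x⁶` (indices run from `0` to `6`); in this frame the Levi-Civita connection is
componentwise differentiation. -/
abbrev E7 := EuclideanSpace ℝ (Fin 7)

/-- The partial derivative `∂F/∂xᵖ` at `x`. -/
def partialD (p : Fin 7) (F : E7 → ℝ) (x : E7) : ℝ :=
  fderiv ℝ F x (EuclideanSpace.single p 1)

/-- The Levi-Civita symbol in dimension seven, `ε_v = ∏_{s < t} sgn (v t - v s)`:
the components of the standard volume form. -/
def levi (v : Fin 7 → Fin 7) : ℤ :=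
  ∏ t : Fin 7, ∏ s ∈ Finset.Iio t, Int.sign (((v t : ℕ) : ℤ) - ((v s : ℕ) : ℤ))

/-- The Euclidean Hodge star of a 3-form `α`, a 4-form:
`(⋆α)_{ijkl} = (1/3!) α_{abc} ε_{abcijkl}`. -/
def hodge (α : Fin 7 → Fin 7 → Fin 7 → ℝ) (i j k l : Fin 7) : ℝ :=
  (1 / 6) * ∑ a, ∑ b, ∑ c, α a b c * (levi ![a, b, c, i, j, k, l] : ℝ)

/-- The components of `dxᵃ ∧ dxᵇ ∧ dxᶜ`: a `3 × 3` determinant of Kronecker deltas. -/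
def dx3 (a b c i j k : Fin 7) : ℝ :=
  let δ : Matrix (Fin 7) (Fin 7) ℝ := 1
  Matrix.det !![δ a i, δ a j, δ a k; δ b i, δ b j, δ b k; δ c i, δ c j, δ c k]

/-- The standard (constant, torsion-free) `G₂`-structure of `ℝ⁷`; with indices from `1` to `7`
it is `e¹²³ - e¹⁶⁷ - e⁵²⁷ - e⁵⁶³ - e⁴¹⁵ - e⁴²⁶ - e⁴³⁷`. It induces the Euclidean metric. -/
def phi0 (i j k : Fin 7) : ℝ :=
  dx3 0 1 2 i j k - dx3 0 5 6 i j k - dx3 4 1 6 i j k - dx3 4 5 2 i j k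
    - dx3 3 0 4 i j k - dx3 3 1 5 i j k - dx3 3 2 6 i j k

/-- The dual 4-form of the standard `G₂`-structure. -/
def psi0 (i j k l : Fin 7) : ℝ := hodge phi0 i j k l

/-- The wedge product of a 1-form and a 2-form. -/
def wedge12 (θ : Fin 7 → ℝ) (β : Fin 7 → Fin 7 → ℝ) (i j k : Fin 7) : ℝ :=
  θ i * β j k + θ j * β k i + θ k * β i j

/-- The `G₂`-structure isometric to the standard one `φ₀` that is given by a function `f` and a
vector field `X` with `f² + |X|² = 1`:
`φ(f, X) = (f² - |X|²) φ₀ - 2 f X ⌟ ψ₀ + 2 X♭ ∧ (X ⌟ φ₀)`. -/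
def phi (f : E7 → ℝ) (X : E7 → E7) (i j k : Fin 7) (x : E7) : ℝ :=
  ((f x) ^ 2 - ‖X x‖ ^ 2) * phi0 i j k
    - 2 * f x * ∑ m, X x m * psi0 m i j k
    + 2 * wedge12 (fun s => X x s) (fun s t => ∑ m, X x m * phi0 m s t) i j k

/-- The dual 4-form `ψ = ⋆φ` of `φ = φ(f, X)`; the metric, the orientation and hence the Hodge star
are the same for all these `G₂`-structures. -/
def psi (f : E7 → ℝ) (X : E7 → E7) (i j k l : Fin 7) (x : E7) : ℝ :=
  hodge (fun a b c => phi f X a b c x) i j k l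

/-- The torsion tensor of `φ = φ(f, X)`, the 2-tensor with `∇_p φ_{ijk} = T_{pq} ψ_{qijk}`, that is
`T_{pq} = (1/24) (∇_p φ_{ijk}) ψ_{qijk}`. -/
def torsion (f : E7 → ℝ) (X : E7 → E7) (p q : Fin 7) (x : E7) : ℝ :=
  (1 / 24) * ∑ i, ∑ j, ∑ k, partialD p (phi f X i j k) x * psi f X q i j k x

/-- The divergence `(div T)_q = ∇_p T_{pq}` of the torsion. -/
def divTorsion (f : E7 → ℝ) (X : E7 → E7) (q : Fin 7) (x : E7) : ℝ :=
  ∑ p, partialD p (torsion f X p q) x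

/-- The contraction `(Y ⌟ T)_q = Y_p T_{pq}` of a vector field with the torsion. -/
def contractTorsion (Y : E7 → E7) (f : E7 → ℝ) (X : E7 → E7) (q : Fin 7) (x : E7) : ℝ :=
  ∑ p, Y x p * torsion f X p q x

/-- The radial vector field `s(r) ∂/∂r`, where `r = ‖x‖` and `∂/∂r = x / r`
(with the value `0` at the origin). -/
def radialField (s : ℝ → ℝ) (x : E7) : E7 := s ‖x‖ • (‖x‖⁻¹ • x)

/-- The equation `div T = c r ∂/∂r ⌟ T` at the point `x`, for the torsion `T` of the
`G₂`-structure `φ(f(r), a(r) ∂/∂r)`. -/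
def SolitonAt (c : ℝ) (a f : ℝ → ℝ) (x : E7) : Prop :=
  ∀ q : Fin 7,
    divTorsion (fun y => f ‖y‖) (radialField a) q x =
      contractTorsion (radialField fun r => c * r) (fun y => f ‖y‖) (radialField a) q x

/-- The ordinary differential equation for `a` and `f` at `r`. -/
def RadialODE (c : ℝ) (a f : ℝ → ℝ) (r : ℝ) : Prop :=
  1 / r * (a r * deriv (deriv f) r - deriv (deriv a) r * f r)
      + 6 / r ^ 2 * (a r * deriv f r - deriv a r * f r)
      + 6 / r ^ 3 * (a r * f r)
    = -c * (deriv a r / f r)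

/-- The ordinary differential equation for `u` at `r`. -/
def SineODE (c : ℝ) (u : ℝ → ℝ) (r : ℝ) : Prop :=
  r ^ 2 * deriv (deriv u) r + (6 - c * r ^ 2) * r * deriv u r - 6 * Real.sin (u r) = 0

end IsometricSoliton

end

open scoped ContDiff

noncomputable section

namespace IsometricSoliton

open Filter Topology

/-- A function of three indices that is totally antisymmetric. -/
structure IsAlternating (A : Fin 7 → Fin 7 → Fin 7 → ℝ) : Prop where
  swap_left : ∀ i j k, A j i k = -A i j k
  swap_right : ∀ i j k, A i k j = -A i j k

lemma IsAlternating.eq_zero_left {A : Fin 7 → Fin 7 → Fin 7 → ℝ} (h : IsAlternating A)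
    (i k : Fin 7) : A i i k = 0 := by
  linarith [h.swap_left i i k]

/-- The `35` strictly increasing triples of indices. -/
def triples : List (Fin 7 × Fin 7 × Fin 7) :=
  [(0, 1, 2), (0, 1, 3), (0, 1, 4), (0, 1, 5), (0, 1, 6), (0, 2, 3), (0, 2, 4),
   (0, 2, 5), (0, 2, 6), (0, 3, 4), (0, 3, 5), (0, 3, 6), (0, 4, 5), (0, 4, 6),
   (0, 5, 6), (1, 2, 3), (1, 2, 4), (1, 2, 5), (1, 2, 6), (1, 3, 4), (1, 3, 5),
   (1, 3, 6), (1, 4, 5), (1, 4, 6), (1, 5, 6), (2, 3, 4), (2, 3, 5), (2, 3, 6),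
   (2, 4, 5), (2, 4, 6), (2, 5, 6), (3, 4, 5), (3, 4, 6), (3, 5, 6), (4, 5, 6)]

lemma sum_increasing (g : Fin 7 → Fin 7 → Fin 7 → ℝ) :
    ∑ i, ∑ j, ∑ k, (if i < j ∧ j < k then g i j k else 0)
      = (triples.map fun s => g s.1 s.2.1 s.2.2).sum := by
  have h : ∀ s : Fin 7 × Fin 7 × Fin 7, s ∈ triples ↔ s.1 < s.2.1 ∧ s.2.1 < s.2.2 := by
    decide +kernel
  have hn : triples.Nodup := by decide +kernel
  rw [← List.sum_toFinset _ hn]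
  have e : triples.toFinset
      = Finset.univ.filter fun s : Fin 7 × Fin 7 × Fin 7 => s.1 < s.2.1 ∧ s.2.1 < s.2.2 := by
    ext s
    simp [h]
  rw [e, Finset.sum_filter, Fintype.sum_prod_type]
  simp only [Fintype.sum_prod_type]

/-- A symmetric function of three indices that vanishes on the diagonals is summed by summing over
increasing triples. -/
lemma sum_symmetric (g : Fin 7 → Fin 7 → Fin 7 → ℝ) (h1 : ∀ i j k, g j i k = g i j k)
    (h2 : ∀ i j k, g i k j = g i j k) (h0 : ∀ i k, g i i k = 0) :
    ∑ i, ∑ j, ∑ k, g i j k = 6 * (triples.map fun s => g s.1 s.2.1 s.2.2).sum := by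
  rw [← sum_increasing]
  set F : Fin 7 → Fin 7 → Fin 7 → ℝ := fun i j k => if i < j ∧ j < k then g i j k else 0 with hF
  have key : ∀ i j k, g i j k = F i j k + F j i k + F i k j + F k i j + F j k i + F k j i := by
    intro i j k
    have e1 := h1 i j k
    have e2 := h2 i j k
    have e3 : g k i j = g i j k := by rw [h1, h2]
    have e4 : g j k i = g i j k := by rw [h2, h1]
    have e5 : g k j i = g i j k := by rw [h1, h2, h1]
    simp only [hF, e1, e2, e3, e4, e5]
    rcases lt_trichotomy i j with hij | hij | hij <;>
    rcases lt_trichotomy j k with hjk | hjk | hjk <;>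
    rcases lt_trichotomy i k with hik | hik | hik <;>
    first
      | (exfalso; omega)
      | (subst hij; simp [h0])
      | (have : g i j k = 0 := by
           first
             | (subst hjk; rw [← h1, ← h2]; exact h0 _ _)
             | (subst hik; rw [← h2]; exact h0 _ _)
         simp [this])
      | simp [hij, hjk, hik, hij.not_gt, hjk.not_gt, hik.not_gt]
  have s1 : ∑ i, ∑ j, ∑ k, F j i k = ∑ i, ∑ j, ∑ k, F i j k := Finset.sum_comm
  have s2 : ∑ i, ∑ j, ∑ k, F i k j = ∑ i, ∑ j, ∑ k, F i j k :=
    Finset.sum_congr rfl fun i _ => Finset.sum_comm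
  have s3 : ∑ i, ∑ j, ∑ k, F k i j = ∑ i, ∑ j, ∑ k, F i j k :=
    (Finset.sum_congr rfl fun i _ => Finset.sum_comm).trans Finset.sum_comm
  have s4 : ∑ i, ∑ j, ∑ k, F j k i = ∑ i, ∑ j, ∑ k, F i j k :=
    Finset.sum_comm.trans (Finset.sum_congr rfl fun i _ => Finset.sum_comm)
  have s5 : ∑ i, ∑ j, ∑ k, F k j i = ∑ i, ∑ j, ∑ k, F i j k :=
    (Finset.sum_congr rfl fun i _ => Finset.sum_comm).trans s4
  calc ∑ i, ∑ j, ∑ k, g i j k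
      = ∑ i, ∑ j, ∑ k, (F i j k + F j i k + F i k j + F k i j + F j k i + F k j i) :=
        Finset.sum_congr rfl fun i _ => Finset.sum_congr rfl fun j _ =>
          Finset.sum_congr rfl fun k _ => key i j k
    _ = 6 * ∑ i, ∑ j, ∑ k, F i j k := by
        simp only [Finset.sum_add_distrib, s1, s2, s3, s4, s5]
        ring

/-- The sign of `y - x`. -/
def indexSign (x y : Fin 7) : ℤ := if x < y then 1 else if y < x then -1 else 0

lemma indexSign_swap (x y : Fin 7) : indexSign y x = -indexSign x y := by
  revert x y
  decide +kernel

lemma sign_sub_eq (x y : Fin 7) :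
    Int.sign (((y : ℕ) : ℤ) - ((x : ℕ) : ℤ)) = indexSign x y := by
  revert x y
  decide +kernel

/-- The Levi-Civita symbol, written out. -/
def leviProd (a b c d e f g : Fin 7) : ℤ :=
  indexSign a b * (indexSign a c * indexSign b c)
    * (indexSign a d * indexSign b d * indexSign c d)
    * (indexSign a e * indexSign b e * indexSign c e * indexSign d e)
    * (indexSign a f * indexSign b f * indexSign c f * indexSign d f * indexSign e f)
    * (indexSign a g * indexSign b g * indexSign c g * indexSign d g * indexSign e g
      * indexSign f g)

lemma levi_eq (a b c d e f g : Fin 7) : levi ![a, b, c, d, e, f, g] = leviProd a b c d e f g := by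
  have h : ∀ n : Fin 7, Finset.Iio n = Finset.univ.filter (· < n) := by decide +kernel
  simp only [levi, sign_sub_eq, leviProd, h, Finset.prod_filter, Fin.prod_univ_seven]
  simp [mul_assoc]

lemma leviProd_swap12 (a b c d e f g : Fin 7) :
    leviProd b a c d e f g = -leviProd a b c d e f g := by
  simp only [leviProd, indexSign_swap a b]
  ring

lemma leviProd_swap23 (a b c d e f g : Fin 7) :
    leviProd a c b d e f g = -leviProd a b c d e f g := by
  simp only [leviProd, indexSign_swap b c]
  ring

lemma leviProd_swap56 (a b c d e f g : Fin 7) :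
    leviProd a b c d f e g = -leviProd a b c d e f g := by
  simp only [leviProd, indexSign_swap e f]
  ring

lemma leviProd_swap67 (a b c d e f g : Fin 7) :
    leviProd a b c d e g f = -leviProd a b c d e f g := by
  simp only [leviProd, indexSign_swap f g]
  ring

/-- The Hodge star of an alternating tensor, as a sum over increasing triples. -/
lemma hodge_eq {C : Fin 7 → Fin 7 → Fin 7 → ℝ} (hC : IsAlternating C) (i j k l : Fin 7) :
    hodge C i j k l
      = (triples.map fun t => C t.1 t.2.1 t.2.2 * (leviProd t.1 t.2.1 t.2.2 i j k l : ℝ)).sum := by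
  simp only [hodge, levi_eq]
  rw [sum_symmetric fun a b c => C a b c * (leviProd a b c i j k l : ℝ)]
  · ring
  · intro a b c
    rw [hC.swap_left, leviProd_swap12]
    push_cast
    ring
  · intro a b c
    rw [hC.swap_right, leviProd_swap23]
    push_cast
    ring
  · intro a c
    simp [hC.eq_zero_left]

lemma sum_map_product {α β : Type*} (l : List α) (m : List β) (G : α → β → ℝ) :
    (l.map fun s => (m.map fun t => G s t).sum).sum
      = ((l ×ˢ m).map fun p => G p.1 p.2).sum := by
  induction l with
  | nil => rfl
  | cons s l ih => simp [List.product_cons, ih, Function.comp_def]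

lemma sum_map_filter {β : Type*} (l : List β) (w : β → ℤ) (F : β → ℝ) :
    (l.map fun b => (w b : ℝ) * F b).sum
      = (((l.map fun b => (w b, b)).filter fun z => z.1 ≠ 0).map
          fun z => (z.1 : ℝ) * F z.2).sum := by
  induction l with
  | nil => rfl
  | cons b l ih =>
    by_cases h : w b = 0
    · simpa [h] using ih
    · simpa [h] using ih

/-- The nonzero terms `(ε_{tqs}, s, t)` with `s` and `t` increasing. -/
def complements : Fin 7 → List (ℤ × (Fin 7 × Fin 7 × Fin 7) × (Fin 7 × Fin 7 × Fin 7)) :=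
  ![
    [(1, (1, 2, 3), (4, 5, 6)), (-1, (1, 2, 4), (3, 5, 6)), (1, (1, 2, 5), (3, 4, 6)), (-1, (1,
      2, 6), (3, 4, 5)), (1, (1, 3, 4), (2, 5, 6)), (-1, (1, 3, 5), (2, 4, 6)), (1, (1, 3, 6), (2,
      4, 5)), (1, (1, 4, 5), (2, 3, 6)), (-1, (1, 4, 6), (2, 3, 5)), (1, (1, 5, 6), (2, 3, 4)),
      (-1, (2, 3, 4), (1, 5, 6)), (1, (2, 3, 5), (1, 4, 6)), (-1, (2, 3, 6), (1, 4, 5)), (-1, (2,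
      4, 5), (1, 3, 6)), (1, (2, 4, 6), (1, 3, 5)), (-1, (2, 5, 6), (1, 3, 4)), (1, (3, 4, 5), (1,
      2, 6)), (-1, (3, 4, 6), (1, 2, 5)), (1, (3, 5, 6), (1, 2, 4)), (-1, (4, 5, 6), (1, 2, 3))],
    [(-1, (0, 2, 3), (4, 5, 6)), (1, (0, 2, 4), (3, 5, 6)), (-1, (0, 2, 5), (3, 4, 6)), (1, (0,
      2, 6), (3, 4, 5)), (-1, (0, 3, 4), (2, 5, 6)), (1, (0, 3, 5), (2, 4, 6)), (-1, (0, 3, 6),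
      (2, 4, 5)), (-1, (0, 4, 5), (2, 3, 6)), (1, (0, 4, 6), (2, 3, 5)), (-1, (0, 5, 6), (2, 3,
      4)), (1, (2, 3, 4), (0, 5, 6)), (-1, (2, 3, 5), (0, 4, 6)), (1, (2, 3, 6), (0, 4, 5)), (1,
      (2, 4, 5), (0, 3, 6)), (-1, (2, 4, 6), (0, 3, 5)), (1, (2, 5, 6), (0, 3, 4)), (-1, (3, 4,
      5), (0, 2, 6)), (1, (3, 4, 6), (0, 2, 5)), (-1, (3, 5, 6), (0, 2, 4)), (1, (4, 5, 6), (0, 2,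
      3))],
    [(1, (0, 1, 3), (4, 5, 6)), (-1, (0, 1, 4), (3, 5, 6)), (1, (0, 1, 5), (3, 4, 6)), (-1, (0,
      1, 6), (3, 4, 5)), (1, (0, 3, 4), (1, 5, 6)), (-1, (0, 3, 5), (1, 4, 6)), (1, (0, 3, 6), (1,
      4, 5)), (1, (0, 4, 5), (1, 3, 6)), (-1, (0, 4, 6), (1, 3, 5)), (1, (0, 5, 6), (1, 3, 4)),
      (-1, (1, 3, 4), (0, 5, 6)), (1, (1, 3, 5), (0, 4, 6)), (-1, (1, 3, 6), (0, 4, 5)), (-1, (1,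
      4, 5), (0, 3, 6)), (1, (1, 4, 6), (0, 3, 5)), (-1, (1, 5, 6), (0, 3, 4)), (1, (3, 4, 5), (0,
      1, 6)), (-1, (3, 4, 6), (0, 1, 5)), (1, (3, 5, 6), (0, 1, 4)), (-1, (4, 5, 6), (0, 1, 3))],
    [(-1, (0, 1, 2), (4, 5, 6)), (1, (0, 1, 4), (2, 5, 6)), (-1, (0, 1, 5), (2, 4, 6)), (1, (0,
      1, 6), (2, 4, 5)), (-1, (0, 2, 4), (1, 5, 6)), (1, (0, 2, 5), (1, 4, 6)), (-1, (0, 2, 6),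
      (1, 4, 5)), (-1, (0, 4, 5), (1, 2, 6)), (1, (0, 4, 6), (1, 2, 5)), (-1, (0, 5, 6), (1, 2,
      4)), (1, (1, 2, 4), (0, 5, 6)), (-1, (1, 2, 5), (0, 4, 6)), (1, (1, 2, 6), (0, 4, 5)), (1,
      (1, 4, 5), (0, 2, 6)), (-1, (1, 4, 6), (0, 2, 5)), (1, (1, 5, 6), (0, 2, 4)), (-1, (2, 4,
      5), (0, 1, 6)), (1, (2, 4, 6), (0, 1, 5)), (-1, (2, 5, 6), (0, 1, 4)), (1, (4, 5, 6), (0, 1,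
      2))],
    [(1, (0, 1, 2), (3, 5, 6)), (-1, (0, 1, 3), (2, 5, 6)), (1, (0, 1, 5), (2, 3, 6)), (-1, (0,
      1, 6), (2, 3, 5)), (1, (0, 2, 3), (1, 5, 6)), (-1, (0, 2, 5), (1, 3, 6)), (1, (0, 2, 6), (1,
      3, 5)), (1, (0, 3, 5), (1, 2, 6)), (-1, (0, 3, 6), (1, 2, 5)), (1, (0, 5, 6), (1, 2, 3)),
      (-1, (1, 2, 3), (0, 5, 6)), (1, (1, 2, 5), (0, 3, 6)), (-1, (1, 2, 6), (0, 3, 5)), (-1, (1,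
      3, 5), (0, 2, 6)), (1, (1, 3, 6), (0, 2, 5)), (-1, (1, 5, 6), (0, 2, 3)), (1, (2, 3, 5), (0,
      1, 6)), (-1, (2, 3, 6), (0, 1, 5)), (1, (2, 5, 6), (0, 1, 3)), (-1, (3, 5, 6), (0, 1, 2))],
    [(-1, (0, 1, 2), (3, 4, 6)), (1, (0, 1, 3), (2, 4, 6)), (-1, (0, 1, 4), (2, 3, 6)), (1, (0,
      1, 6), (2, 3, 4)), (-1, (0, 2, 3), (1, 4, 6)), (1, (0, 2, 4), (1, 3, 6)), (-1, (0, 2, 6),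
      (1, 3, 4)), (-1, (0, 3, 4), (1, 2, 6)), (1, (0, 3, 6), (1, 2, 4)), (-1, (0, 4, 6), (1, 2,
      3)), (1, (1, 2, 3), (0, 4, 6)), (-1, (1, 2, 4), (0, 3, 6)), (1, (1, 2, 6), (0, 3, 4)), (1,
      (1, 3, 4), (0, 2, 6)), (-1, (1, 3, 6), (0, 2, 4)), (1, (1, 4, 6), (0, 2, 3)), (-1, (2, 3,
      4), (0, 1, 6)), (1, (2, 3, 6), (0, 1, 4)), (-1, (2, 4, 6), (0, 1, 3)), (1, (3, 4, 6), (0, 1,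
      2))],
    [(1, (0, 1, 2), (3, 4, 5)), (-1, (0, 1, 3), (2, 4, 5)), (1, (0, 1, 4), (2, 3, 5)), (-1, (0,
      1, 5), (2, 3, 4)), (1, (0, 2, 3), (1, 4, 5)), (-1, (0, 2, 4), (1, 3, 5)), (1, (0, 2, 5), (1,
      3, 4)), (1, (0, 3, 4), (1, 2, 5)), (-1, (0, 3, 5), (1, 2, 4)), (1, (0, 4, 5), (1, 2, 3)),
      (-1, (1, 2, 3), (0, 4, 5)), (1, (1, 2, 4), (0, 3, 5)), (-1, (1, 2, 5), (0, 3, 4)), (-1, (1,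
      3, 4), (0, 2, 5)), (1, (1, 3, 5), (0, 2, 4)), (-1, (1, 4, 5), (0, 2, 3)), (1, (2, 3, 4), (0,
      1, 5)), (-1, (2, 3, 5), (0, 1, 4)), (1, (2, 4, 5), (0, 1, 3)), (-1, (3, 4, 5), (0, 1, 2))]]

lemma complements_eq (q : Fin 7) :
    ((triples ×ˢ triples).map fun p =>
      (leviProd p.2.1 p.2.2.1 p.2.2.2 q p.1.1 p.1.2.1 p.1.2.2, p)).filter (fun z => z.1 ≠ 0)
      = complements q := by
  revert q
  decide +kernel

/-- The contraction of a 3-form with the Hodge star of a 3-form, in components. -/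
lemma sum_mul_hodge {A C : Fin 7 → Fin 7 → Fin 7 → ℝ} (hA : IsAlternating A)
    (hC : IsAlternating C) (q : Fin 7) :
    ∑ i, ∑ j, ∑ k, A i j k * hodge C q i j k
      = 6 * ((complements q).map fun z => (z.1 : ℝ) *
          (A z.2.1.1 z.2.1.2.1 z.2.1.2.2 * C z.2.2.1 z.2.2.2.1 z.2.2.2.2)).sum := by
  have h1 : ∀ i j k, hodge C q j i k = -hodge C q i j k := by
    intro i j k
    simp only [hodge, levi_eq, leviProd_swap56 _ _ _ q i j k]
    simp
  have h2 : ∀ i j k, hodge C q i k j = -hodge C q i j k := by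
    intro i j k
    simp only [hodge, levi_eq, leviProd_swap67 _ _ _ q i j k]
    simp
  rw [sum_symmetric fun i j k => A i j k * hodge C q i j k]
  · rw [← complements_eq, ← sum_map_filter (triples ×ˢ triples)
      (fun p => leviProd p.2.1 p.2.2.1 p.2.2.2 q p.1.1 p.1.2.1 p.1.2.2)
      (fun p => A p.1.1 p.1.2.1 p.1.2.2 * C p.2.1 p.2.2.1 p.2.2.2),
      ← sum_map_product triples triples fun s t =>
        (leviProd t.1 t.2.1 t.2.2 q s.1 s.2.1 s.2.2 : ℝ)
          * (A s.1 s.2.1 s.2.2 * C t.1 t.2.1 t.2.2)]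
    congr 2
    refine List.map_congr_left fun s _ => ?_
    rw [hodge_eq hC, ← List.sum_map_mul_left]
    congr 1
    refine List.map_congr_left fun t _ => ?_
    ring
  · intro i j k
    rw [hA.swap_left, h1]
    ring
  · intro i j k
    rw [hA.swap_right, h2]
    ring
  · intro i k
    simp [hA.eq_zero_left]

/-- `dx3` with integer values. -/
def dx3Int (a b c i j k : Fin 7) : ℤ :=
  let δ (s t : Fin 7) : ℤ := if s = t then 1 else 0
  δ a i * δ b j * δ c k - δ a i * δ b k * δ c j - δ a j * δ b i * δ c k
    + δ a j * δ b k * δ c i + δ a k * δ b i * δ c j - δ a k * δ b j * δ c i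

lemma dx3_eq (a b c i j k : Fin 7) : dx3 a b c i j k = (dx3Int a b c i j k : ℝ) := by
  simp only [dx3, Matrix.det_fin_three, Matrix.one_apply, dx3Int]
  push_cast
  rfl

/-- `phi0` with integer values. -/
def phiInt (i j k : Fin 7) : ℤ :=
  dx3Int 0 1 2 i j k - dx3Int 0 5 6 i j k - dx3Int 4 1 6 i j k - dx3Int 4 5 2 i j k
    - dx3Int 3 0 4 i j k - dx3Int 3 1 5 i j k - dx3Int 3 2 6 i j k

lemma phi0_eq (i j k : Fin 7) : phi0 i j k = (phiInt i j k : ℝ) := by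
  simp only [phi0, dx3_eq, phiInt]
  push_cast
  rfl

lemma isAlternating_phi0 : IsAlternating phi0 := by
  have h : ∀ i j k, phiInt j i k = -phiInt i j k ∧ phiInt i k j = -phiInt i j k := by
    decide +kernel
  constructor
  · intro i j k
    rw [phi0_eq, phi0_eq, (h i j k).1, Int.cast_neg]
  · intro i j k
    rw [phi0_eq, phi0_eq, (h i j k).2, Int.cast_neg]

/-- `psi0` with integer values. -/
def psiInt (i j k l : Fin 7) : ℤ :=
  (triples.map fun t => phiInt t.1 t.2.1 t.2.2 * leviProd t.1 t.2.1 t.2.2 i j k l).sum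

lemma psi0_eq (i j k l : Fin 7) : psi0 i j k l = (psiInt i j k l : ℝ) := by
  rw [psi0, hodge_eq isAlternating_phi0, psiInt, Int.cast_list_sum, List.map_map]
  simp [phi0_eq, Function.comp_def]

lemma psi0_swap23 (i j k l : Fin 7) : psi0 i k j l = -psi0 i j k l := by
  simp only [psi0, hodge, levi_eq, leviProd_swap56 _ _ _ i j k l]
  simp

lemma psi0_swap34 (i j k l : Fin 7) : psi0 i j l k = -psi0 i j k l := by
  simp only [psi0, hodge, levi_eq, leviProd_swap67 _ _ _ i j k l]
  simp

/-- The pairs `(φ₀ m s t, m)` for the only index `m` with `φ₀ m s t ≠ 0`. -/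
def phiEntries : Fin 7 → Fin 7 → ℤ × Fin 7 :=
  ![
  ![(0, 0), (1, 2), (-1, 1), (1, 4), (-1, 3), (-1, 6), (1, 5)],
    ![(-1, 2), (0, 0), (1, 0), (1, 5), (1, 6), (-1, 3), (-1, 4)],
    ![(1, 1), (-1, 0), (0, 0), (1, 6), (-1, 5), (1, 4), (-1, 3)],
    ![(-1, 4), (-1, 5), (-1, 6), (0, 0), (1, 0), (1, 1), (1, 2)],
    ![(1, 3), (-1, 6), (1, 5), (-1, 0), (0, 0), (-1, 2), (1, 1)],
    ![(1, 6), (1, 3), (-1, 4), (-1, 1), (1, 2), (0, 0), (-1, 0)],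
    ![(-1, 5), (1, 4), (1, 3), (-1, 2), (-1, 1), (1, 0), (0, 0)]]

/-- The increasing triples `s`, with `φ₀ s` and `(ψ₀ m s, m)` for the only index `m`
with `ψ₀ m s ≠ 0`. -/
def tripleEntries : List ((Fin 7 × Fin 7 × Fin 7) × ℤ × ℤ × Fin 7) :=
  [((0, 1, 2), 1, 0, 0), ((0, 1, 3), 0, 1, 6), ((0, 1, 4), 0, -1, 5), ((0, 1, 5), 0, 1, 4),
    ((0, 1, 6), 0, -1, 3), ((0, 2, 3), 0, -1, 5), ((0, 2, 4), 0, -1, 6), ((0, 2, 5), 0, 1, 3),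
    ((0, 2, 6), 0, 1, 4), ((0, 3, 4), 1, 0, 0), ((0, 3, 5), 0, -1, 2), ((0, 3, 6), 0, 1, 1),
    ((0, 4, 5), 0, -1, 1), ((0, 4, 6), 0, -1, 2), ((0, 5, 6), -1, 0, 0), ((1, 2, 3), 0, 1, 4),
    ((1, 2, 4), 0, -1, 3), ((1, 2, 5), 0, -1, 6), ((1, 2, 6), 0, 1, 5), ((1, 3, 4), 0, 1, 2),
    ((1, 3, 5), 1, 0, 0), ((1, 3, 6), 0, -1, 0), ((1, 4, 5), 0, 1, 0), ((1, 4, 6), 1, 0, 0),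
    ((1, 5, 6), 0, -1, 2), ((2, 3, 4), 0, -1, 1), ((2, 3, 5), 0, 1, 0), ((2, 3, 6), 1, 0, 0),
    ((2, 4, 5), -1, 0, 0), ((2, 4, 6), 0, 1, 0), ((2, 5, 6), 0, 1, 1), ((3, 4, 5), 0, -1, 6),
    ((3, 4, 6), 0, 1, 5), ((3, 5, 6), 0, -1, 4), ((4, 5, 6), 0, 1, 3)]

lemma contract_phi0 (X : Fin 7 → ℝ) (s t : Fin 7) :
    ∑ m, X m * phi0 m s t = (phiEntries s t).1 * X (phiEntries s t).2 := by
  have h : ∀ s t m, phiInt m s t = if m = (phiEntries s t).2 then (phiEntries s t).1 else 0 := by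
    decide +kernel
  simp [phi0_eq, h, mul_comm]

lemma phi0_and_contract_psi0 (X : Fin 7 → ℝ) : ∀ z ∈ tripleEntries,
    phi0 z.1.1 z.1.2.1 z.1.2.2 = z.2.1
      ∧ ∑ m, X m * psi0 m z.1.1 z.1.2.1 z.1.2.2 = z.2.2.1 * X z.2.2.2 := by
  have h : ∀ z ∈ tripleEntries, phiInt z.1.1 z.1.2.1 z.1.2.2 = z.2.1 ∧
      ∀ m, psiInt m z.1.1 z.1.2.1 z.1.2.2 = if m = z.2.2.2 then z.2.2.1 else 0 := by
    decide +kernel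
  intro z hz
  refine ⟨by rw [phi0_eq, (h z hz).1], ?_⟩
  simp [psi0_eq, (h z hz).2, mul_comm]

/-- The polarization of the quadratic map `(f, X) ↦ φ(f, X)`. -/
def polar (f : ℝ) (X : Fin 7 → ℝ) (g : ℝ) (Y : Fin 7 → ℝ) (i j k : Fin 7) : ℝ :=
  (f * g - ∑ m, X m * Y m) * phi0 i j k
    - (f * ∑ m, Y m * psi0 m i j k + g * ∑ m, X m * psi0 m i j k)
    + (wedge12 X (fun s t => ∑ m, Y m * phi0 m s t) i j k
      + wedge12 Y (fun s t => ∑ m, X m * phi0 m s t) i j k)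

lemma isAlternating_polar (f : ℝ) (X : Fin 7 → ℝ) (g : ℝ) (Y : Fin 7 → ℝ) :
    IsAlternating (polar f X g Y) := by
  have hφ : ∀ (X : Fin 7 → ℝ) s t, ∑ m, X m * phi0 m t s = -∑ m, X m * phi0 m s t := by
    intro X s t
    simp [isAlternating_phi0.swap_right _ s t]
  have hψ : ∀ (X : Fin 7 → ℝ) i j k, ∑ m, X m * psi0 m j i k = -∑ m, X m * psi0 m i j k := by
    intro X i j k
    simp [psi0_swap23 _ i j k]
  have hψ' : ∀ (X : Fin 7 → ℝ) i j k, ∑ m, X m * psi0 m i k j = -∑ m, X m * psi0 m i j k := by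
    intro X i j k
    simp [psi0_swap34 _ i j k]
  constructor
  · intro i j k
    simp only [polar, wedge12, isAlternating_phi0.swap_left i j k, hψ _ i j k, hφ _ i j,
      hφ _ j k, hφ _ k i]
    ring
  · intro i j k
    simp only [polar, wedge12, isAlternating_phi0.swap_right i j k, hψ' _ i j k, hφ _ i j,
      hφ _ j k, hφ _ k i]
    ring

lemma polar_eq (f : ℝ) (X : Fin 7 → ℝ) (g : ℝ) (Y : Fin 7 → ℝ) : ∀ z ∈ tripleEntries,
    polar f X g Y z.1.1 z.1.2.1 z.1.2.2
      = (f * g - ∑ m, X m * Y m) * z.2.1 - z.2.2.1 * (f * Y z.2.2.2 + g * X z.2.2.2)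
        + wedge12 X (fun s t => (phiEntries s t).1 * Y (phiEntries s t).2) z.1.1 z.1.2.1 z.1.2.2
        + wedge12 Y (fun s t => (phiEntries s t).1 * X (phiEntries s t).2)
            z.1.1 z.1.2.1 z.1.2.2 := by
  intro z hz
  have hX := phi0_and_contract_psi0 X z hz
  have hY := phi0_and_contract_psi0 Y z hz
  simp only [polar, contract_phi0, hX.1, hX.2, hY.2]
  ring

set_option maxHeartbeats 4000000 in
/-- The algebraic identity behind the torsion of an isometric `G₂`-structure. -/
lemma sum_polar_mul_hodge (f : ℝ) (X : Fin 7 → ℝ) (g : ℝ) (Y : Fin 7 → ℝ) (q : Fin 7) :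
    ∑ i, ∑ j, ∑ k, polar f X g Y i j k * hodge (polar f X f X) q i j k
      = -24 * (f ^ 2 + ∑ m, X m ^ 2)
        * (f * Y q - g * X q + ∑ i, Y i * ∑ m, X m * phi0 m q i) := by
  have hA := polar_eq f X g Y
  have hC := polar_eq f X f X
  rw [sum_mul_hodge (isAlternating_polar _ _ _ _) (isAlternating_polar _ _ _ _)]
  simp only [contract_phi0]
  generalize polar f X g Y = A at hA ⊢
  generalize polar f X f X = C at hC ⊢
  simp only [tripleEntries, List.forall_mem_cons, List.not_mem_nil, false_imp_iff, implies_true,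
    and_true, Int.cast_zero, Int.cast_one, Int.cast_neg, zero_mul, one_mul, neg_mul, mul_zero,
    mul_one, mul_neg, wedge12, phiEntries, Matrix.cons_val, Fin.sum_univ_seven] at hA hC
  fin_cases q <;>
  · simp only [complements, phiEntries, Fin.sum_univ_seven, Matrix.cons_val, List.map_cons,
      List.map_nil, List.sum_cons, List.sum_nil, Int.cast_one, Int.cast_neg, Int.cast_zero, hA, hC,
      Fin.zero_eta, Fin.mk_one, Fin.reduceFinMk]
    ring

/-- The affine line through `x` in the direction of the `p`-th coordinate. -/
def coordLine (x : E7) (p : Fin 7) (t : ℝ) : E7 := x + t • EuclideanSpace.single p (1 : ℝ)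

lemma coordLine_zero (x : E7) (p : Fin 7) : coordLine x p 0 = x := by
  simp [coordLine]

lemma hasDerivAt_partialD {F : E7 → ℝ} {x : E7} (hF : DifferentiableAt ℝ F x) (p : Fin 7) :
    HasDerivAt (fun t => F (coordLine x p t)) (partialD p F x) 0 :=
  hF.hasFDerivAt.hasLineDerivAt _

lemma partialD_eq {F : E7 → ℝ} {x : E7} {p : Fin 7} {F' : ℝ} (hF : DifferentiableAt ℝ F x)
    (h : HasDerivAt (fun t => F (coordLine x p t)) F' 0) : partialD p F x = F' :=
  (hasDerivAt_partialD hF p).unique h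

lemma partialD_congr {F G : E7 → ℝ} {x : E7} (p : Fin 7) (h : F =ᶠ[𝓝 x] G) :
    partialD p F x = partialD p G x := by
  rw [partialD, partialD, h.fderiv_eq]

lemma phi_eq_polar (f : E7 → ℝ) (X : E7 → E7) (i j k : Fin 7) (x : E7) :
    phi f X i j k x = polar (f x) (fun m => X x m) (f x) (fun m => X x m) i j k := by
  simp only [phi, polar, EuclideanSpace.real_norm_sq_eq, ← sq]
  ring

lemma partialD_phi {f : E7 → ℝ} {X : E7 → E7} {x : E7} (hf : DifferentiableAt ℝ f x)
    (hX : ∀ m, DifferentiableAt ℝ (fun y => X y m) x) (p i j k : Fin 7) :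
    partialD p (phi f X i j k) x
      = 2 * polar (f x) (fun m => X x m) (partialD p f x)
          (fun m => partialD p (fun y => X y m) x) i j k := by
  have e : phi f X i j k
      = fun y => polar (f y) (fun m => X y m) (f y) (fun m => X y m) i j k :=
    funext fun y => phi_eq_polar f X i j k y
  rw [e]
  refine partialD_eq (by simp only [polar, wedge12]; fun_prop) ?_
  have h0 := coordLine_zero x p
  have df := hasDerivAt_partialD hf p
  have dX := fun m => hasDerivAt_partialD (hX m) p
  have dn := HasDerivAt.fun_sum (u := Finset.univ) fun m _ => (dX m).mul (dX m)
  have dψ := HasDerivAt.fun_sum (u := Finset.univ) fun m _ => (dX m).mul_const (psi0 m i j k)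
  have dφ := fun s t =>
    HasDerivAt.fun_sum (u := Finset.univ) fun m _ => (dX m).mul_const (phi0 m s t)
  have dw := (((dX i).mul (dφ j k)).add ((dX j).mul (dφ k i))).add ((dX k).mul (dφ i j))
  refine ((((df.mul df).sub dn).mul_const (phi0 i j k)).sub
    ((df.mul dψ).add (df.mul dψ)) |>.add (dw.add dw)).congr_deriv ?_
  simp only [h0, polar, wedge12, Finset.sum_add_distrib, mul_comm (X x _) (partialD _ _ _)]
  ring

/-- The torsion of `φ(f, X)`, for `f² + |X|² = 1`. -/
theorem torsion_eq {f : E7 → ℝ} {X : E7 → E7} {x : E7} (hf : DifferentiableAt ℝ f x)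
    (hX : ∀ m, DifferentiableAt ℝ (fun y => X y m) x) (h1 : f x ^ 2 + ‖X x‖ ^ 2 = 1)
    (p q : Fin 7) :
    torsion f X p q x
      = -2 * (f x * partialD p (fun y => X y q) x - partialD p f x * X x q
          + ∑ i, partialD p (fun y => X y i) x * ∑ m, X x m * phi0 m q i) := by
  have h := sum_polar_mul_hodge (f x) (fun m => X x m) (partialD p f x)
    (fun m => partialD p (fun y => X y m) x) q
  rw [← EuclideanSpace.real_norm_sq_eq, h1] at h
  simp only [torsion, psi, partialD_phi hf hX, phi_eq_polar, mul_assoc (2 : ℝ), ← Finset.mul_sum]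
  rw [h]
  ring

lemma hasDerivAt_coordLine_apply (x : E7) (p i : Fin 7) (t : ℝ) :
    HasDerivAt (fun t => coordLine x p t i) (if i = p then 1 else 0) t := by
  have e : (fun t => coordLine x p t i) = fun t => x i + t * if i = p then 1 else 0 := by
    funext t
    simp [coordLine]
  rw [e]
  simpa using ((hasDerivAt_id t).mul_const (if i = p then (1 : ℝ) else 0)).const_add (x i)

lemma hasDerivAt_norm_coordLine {x : E7} (hx : x ≠ 0) (p : Fin 7) :
    HasDerivAt (fun t => ‖coordLine x p t‖) (x p / ‖x‖) 0 := by
  have h : HasDerivAt (fun t => ∑ i, coordLine x p t i ^ 2) (2 * x p) 0 := by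
    refine (HasDerivAt.fun_sum (u := Finset.univ) fun i _ =>
      (hasDerivAt_coordLine_apply x p i 0).pow 2).congr_deriv ?_
    simp [coordLine_zero]
  have hs : ∑ i, coordLine x p 0 i ^ 2 = ‖x‖ ^ 2 := by
    rw [coordLine_zero, EuclideanSpace.real_norm_sq_eq]
  have hx' : ‖x‖ ≠ 0 := norm_ne_zero_iff.2 hx
  have := h.sqrt (by rw [hs]; positivity)
  rw [hs, Real.sqrt_sq (norm_nonneg x)] at this
  simp only [EuclideanSpace.norm_eq, Real.norm_eq_abs, sq_abs]
  rw [← Real.sqrt_sq (norm_nonneg x), EuclideanSpace.real_norm_sq_eq] at this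
  refine this.congr_deriv ?_
  field_simp

lemma differentiableAt_norm {x : E7} (hx : x ≠ 0) : DifferentiableAt ℝ (fun y : E7 => ‖y‖) x :=
  differentiableAt_id.norm ℝ hx

lemma hasDerivAt_radial {x : E7} (hx : x ≠ 0) {s : ℝ → ℝ} {s' : ℝ}
    (hs : HasDerivAt s s' ‖x‖) (p : Fin 7) :
    HasDerivAt (fun t => s ‖coordLine x p t‖) (s' * (x p / ‖x‖)) 0 := by
  have h := hasDerivAt_norm_coordLine hx p
  exact HasDerivAt.comp (h₂ := s) 0 (by rwa [coordLine_zero]) h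

lemma differentiableAt_radial {x : E7} (hx : x ≠ 0) {s : ℝ → ℝ}
    (hs : DifferentiableAt ℝ s ‖x‖) : DifferentiableAt ℝ (fun y : E7 => s ‖y‖) x :=
  DifferentiableAt.comp (g := s) x hs (differentiableAt_norm hx)

lemma partialD_radial {x : E7} (hx : x ≠ 0) {s : ℝ → ℝ} (hs : DifferentiableAt ℝ s ‖x‖)
    (p : Fin 7) : partialD p (fun y => s ‖y‖) x = deriv s ‖x‖ * (x p / ‖x‖) :=
  partialD_eq (differentiableAt_radial hx hs) (hasDerivAt_radial hx hs.hasDerivAt p)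

lemma radialField_apply (s : ℝ → ℝ) (x : E7) (i : Fin 7) :
    radialField s x i = s ‖x‖ / ‖x‖ * x i := by
  simp only [radialField, PiLp.smul_apply, smul_eq_mul]
  ring

lemma differentiableAt_radialField {x : E7} (hx : x ≠ 0) {s : ℝ → ℝ}
    (hs : DifferentiableAt ℝ s ‖x‖) (i : Fin 7) :
    DifferentiableAt ℝ (fun y => radialField s y i) x := by
  simp only [radialField_apply]
  have := differentiableAt_radial hx hs
  have := differentiableAt_norm hx
  have := norm_ne_zero_iff.2 hx
  fun_prop (disch := assumption)

lemma partialD_radialField {x : E7} (hx : x ≠ 0) {s : ℝ → ℝ}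
    (hs : DifferentiableAt ℝ s ‖x‖) (p i : Fin 7) :
    partialD p (fun y => radialField s y i) x
      = s ‖x‖ / ‖x‖ * (if i = p then 1 else 0)
        + (deriv s ‖x‖ - s ‖x‖ / ‖x‖) / ‖x‖ ^ 2 * (x p * x i) := by
  refine partialD_eq (differentiableAt_radialField hx hs i) ?_
  have hx' : ‖x‖ ≠ 0 := norm_ne_zero_iff.2 hx
  simp only [radialField_apply]
  refine (((hasDerivAt_radial hx hs.hasDerivAt p).div (hasDerivAt_norm_coordLine hx p)
    (by rwa [coordLine_zero])).mul (hasDerivAt_coordLine_apply x p i 0)).congr_deriv ?_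
  simp only [Pi.div_apply, coordLine_zero]
  field_simp
  ring

lemma sum_sum_phi0 (x : E7) (q : Fin 7) : ∑ i, x i * ∑ m, x m * phi0 m q i = 0 := by
  have h : ∑ i, x i * ∑ m, x m * phi0 m q i = -∑ i, x i * ∑ m, x m * phi0 m q i := by
    conv_lhs =>
      simp only [Finset.mul_sum]
      rw [Finset.sum_comm]
    simp only [Finset.mul_sum, ← Finset.sum_neg_distrib]
    refine Finset.sum_congr rfl fun i _ => Finset.sum_congr rfl fun m _ => ?_
    rw [isAlternating_phi0.swap_right i m q, isAlternating_phi0.swap_left m i q,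
      isAlternating_phi0.swap_right m i q]
    ring
  linarith

/-- The radial-radial component of `f ∇X - ∇f X` for `X = a(r) ∂/∂r`. -/
def wronskian (a f : ℝ → ℝ) (r : ℝ) : ℝ := f r * deriv a r - deriv f r * a r

/-- The torsion of `φ(f(r), a(r) ∂/∂r)` away from the origin. -/
theorem torsion_radial {a f : ℝ → ℝ} {x : E7} (hx : x ≠ 0) (ha : DifferentiableAt ℝ a ‖x‖)
    (hf : DifferentiableAt ℝ f ‖x‖) (haf : f ‖x‖ ^ 2 + a ‖x‖ ^ 2 = 1) (p q : Fin 7) :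
    torsion (fun y => f ‖y‖) (radialField a) p q x
      = -2 * (f ‖x‖ * a ‖x‖ / ‖x‖ * (if q = p then 1 else 0)
        + (wronskian a f ‖x‖ - f ‖x‖ * a ‖x‖ / ‖x‖) / ‖x‖ ^ 2 * (x p * x q)
        + (a ‖x‖ / ‖x‖) ^ 2 * ∑ m, x m * phi0 m q p) := by
  have hx' : ‖x‖ ≠ 0 := norm_ne_zero_iff.2 hx
  have hn : ‖radialField a x‖ ^ 2 = a ‖x‖ ^ 2 := by
    simp [radialField, norm_smul, hx']
  rw [torsion_eq (differentiableAt_radial hx hf) (differentiableAt_radialField hx ha)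
    (by rw [hn, haf])]
  have hs : ∑ i, partialD p (fun y => radialField a y i) x * ∑ m, radialField a x m * phi0 m q i
      = (a ‖x‖ / ‖x‖) ^ 2 * ∑ m, x m * phi0 m q p := by
    simp only [partialD_radialField hx ha]
    simp only [radialField_apply, add_mul, Finset.sum_add_distrib,
      mul_assoc (a ‖x‖ / ‖x‖), ← Finset.mul_sum, ite_mul, one_mul, zero_mul,
      Finset.sum_ite_eq', Finset.mem_univ, if_true]
    have e : ∀ i, (deriv a ‖x‖ - a ‖x‖ / ‖x‖) / ‖x‖ ^ 2 * (x p * x i)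
        * (a ‖x‖ / ‖x‖ * ∑ m, x m * phi0 m q i)
        = (deriv a ‖x‖ - a ‖x‖ / ‖x‖) / ‖x‖ ^ 2 * x p * (a ‖x‖ / ‖x‖)
          * (x i * ∑ m, x m * phi0 m q i) := fun i => by ring
    simp only [e, ← Finset.mul_sum, sum_sum_phi0]
    ring
  rw [hs, partialD_radial hx hf, partialD_radialField hx ha, radialField_apply, wronskian]
  field_simp
  ring

lemma phi0_eq_zero_outer (p q : Fin 7) : phi0 p q p = 0 := by
  rw [isAlternating_phi0.swap_right, isAlternating_phi0.eq_zero_left, neg_zero]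

/-- The divergence of a 2-tensor of the form of the torsion of a radial isometric structure. -/
lemma sum_partialD_radial {α β γ : ℝ → ℝ} {α' β' γ' : ℝ} {x : E7} (hx : x ≠ 0)
    (hα : HasDerivAt α α' ‖x‖) (hβ : HasDerivAt β β' ‖x‖) (hγ : HasDerivAt γ γ' ‖x‖)
    (q : Fin 7) :
    ∑ p, partialD p (fun y => -2 * (α ‖y‖ * (if q = p then 1 else 0) + β ‖y‖ * (y p * y q)
        + γ ‖y‖ * ∑ m, y m * phi0 m q p)) x
      = -2 * (α' / ‖x‖ + β' * ‖x‖ + 8 * β ‖x‖) * x q := by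
  have hx' : ‖x‖ ≠ 0 := norm_ne_zero_iff.2 hx
  have h : ∀ p, partialD p (fun y => -2 * (α ‖y‖ * (if q = p then 1 else 0)
        + β ‖y‖ * (y p * y q) + γ ‖y‖ * ∑ m, y m * phi0 m q p)) x
      = -2 * (α' / ‖x‖ * (x p * if q = p then 1 else 0)
          + (β' / ‖x‖ * x q) * x p ^ 2 + β ‖x‖ * (x q + x p * if q = p then 1 else 0)
          + γ' / ‖x‖ * (x p * ∑ m, x m * phi0 m q p)) := by
    intro p
    have dα := differentiableAt_radial hx hα.differentiableAt
    have dβ := differentiableAt_radial hx hβ.differentiableAt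
    have dγ := differentiableAt_radial hx hγ.differentiableAt
    refine partialD_eq ((((dα.mul_const _).add (dβ.mul (by fun_prop))).add
      (dγ.mul (by fun_prop))).const_mul _) ?_
    have dm := fun m => hasDerivAt_coordLine_apply x p m 0
    refine (((((hasDerivAt_radial hx hα p).mul_const (if q = p then (1 : ℝ) else 0)).add
      ((hasDerivAt_radial hx hβ p).mul ((dm p).mul (dm q)))).add
      ((hasDerivAt_radial hx hγ p).mul (HasDerivAt.fun_sum (u := Finset.univ) fun m _ =>
        (dm m).mul_const (phi0 m q p)))).const_mul (-2)).congr_deriv ?_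
    simp only [Pi.mul_apply, coordLine_zero, ite_mul, one_mul, zero_mul, Finset.sum_ite_eq',
      Finset.mem_univ, if_true, phi0_eq_zero_outer]
    ring
  rw [Finset.sum_congr rfl fun p _ => h p]
  simp only [← Finset.mul_sum, Finset.sum_add_distrib, sum_sum_phi0,
    ← EuclideanSpace.real_norm_sq_eq, mul_ite, mul_one, mul_zero, Finset.sum_ite_eq,
    Finset.mem_univ, if_true, Finset.sum_const, Finset.card_univ, Fintype.card_fin]
  field_simp
  ring

/-- The radial component of `(div T - c r ∂/∂r ⌟ T) / (-2 r)`. -/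
def radialDefect (c : ℝ) (a f : ℝ → ℝ) (r : ℝ) : ℝ :=
  (f r * deriv (deriv a) r - deriv (deriv f) r * a r) / r
    + 6 * (wronskian a f r - f r * a r / r) / r ^ 2 - c * wronskian a f r

lemma hasDerivAt_wronskian {a f : ℝ → ℝ} (ha : ContDiff ℝ ∞ a) (hf : ContDiff ℝ ∞ f) (r : ℝ) :
    HasDerivAt (wronskian a f) (f r * deriv (deriv a) r - deriv (deriv f) r * a r) r := by
  have da : HasDerivAt a (deriv a r) r := (ha.differentiable (by simp) r).hasDerivAt
  have df : HasDerivAt f (deriv f r) r := (hf.differentiable (by simp) r).hasDerivAt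
  have da' : HasDerivAt (deriv a) (deriv (deriv a) r) r :=
    ((ha.deriv' (n := ∞)).differentiable (by simp) r).hasDerivAt
  have df' : HasDerivAt (deriv f) (deriv (deriv f) r) r :=
    ((hf.deriv' (n := ∞)).differentiable (by simp) r).hasDerivAt
  refine ((df.mul da').sub (df'.mul da)).congr_deriv ?_
  ring

lemma divTorsion_radial {a f : ℝ → ℝ} (ha : ContDiff ℝ ∞ a) (hf : ContDiff ℝ ∞ f)
    (haf : ∀ r, f r ^ 2 + a r ^ 2 = 1) {x : E7} (hx : x ≠ 0) (q : Fin 7) :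
    divTorsion (fun y => f ‖y‖) (radialField a) q x
      = -2 * ((f ‖x‖ * deriv (deriv a) ‖x‖ - deriv (deriv f) ‖x‖ * a ‖x‖) / ‖x‖
        + 6 * (wronskian a f ‖x‖ - f ‖x‖ * a ‖x‖ / ‖x‖) / ‖x‖ ^ 2) * x q := by
  have hx' : ‖x‖ ≠ 0 := norm_ne_zero_iff.2 hx
  have da : Differentiable ℝ a := ha.differentiable (by simp)
  have df : Differentiable ℝ f := hf.differentiable (by simp)
  set r := ‖x‖ with hr
  have hid := hasDerivAt_id' r
  have hα := ((df r).hasDerivAt.mul (da r).hasDerivAt).div hid hx'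
  have hβ := ((hasDerivAt_wronskian ha hf r).sub hα).div (hid.pow 2) (pow_ne_zero 2 hx')
  have hγ := ((da r).hasDerivAt.div hid hx').pow 2
  have h := sum_partialD_radial hx hα hβ hγ q
  rw [divTorsion]
  have e : ∀ p, partialD p (torsion (fun y => f ‖y‖) (radialField a) p q) x = _ := fun p =>
    partialD_congr p ((eventually_ne_nhds hx).mono fun y hy =>
      torsion_radial hy (da _) (df _) (haf _) p q)
  simp only [e]
  refine h.trans ?_
  simp only [Pi.mul_apply, Pi.sub_apply, Pi.div_apply, Pi.pow_apply, ← hr]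
  field_simp
  ring

lemma contractTorsion_radial {a f : ℝ → ℝ} (ha : ContDiff ℝ ∞ a) (hf : ContDiff ℝ ∞ f)
    (haf : ∀ r, f r ^ 2 + a r ^ 2 = 1) (c : ℝ) {x : E7} (hx : x ≠ 0) (q : Fin 7) :
    contractTorsion (radialField fun r => c * r) (fun y => f ‖y‖) (radialField a) q x
      = -2 * (c * wronskian a f ‖x‖) * x q := by
  have hx' : ‖x‖ ≠ 0 := norm_ne_zero_iff.2 hx
  have h : ∀ p, radialField (fun r => c * r) x p
      * torsion (fun y => f ‖y‖) (radialField a) p q x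
      = -2 * c * (f ‖x‖ * a ‖x‖ / ‖x‖ * (x p * if q = p then 1 else 0)
        + (wronskian a f ‖x‖ - f ‖x‖ * a ‖x‖ / ‖x‖) / ‖x‖ ^ 2 * x q * x p ^ 2
        + (a ‖x‖ / ‖x‖) ^ 2 * (x p * ∑ m, x m * phi0 m q p)) := by
    intro p
    rw [torsion_radial hx (ha.differentiable (by simp) _) (hf.differentiable (by simp) _) (haf _),
      radialField_apply, mul_div_cancel_right₀ _ hx']
    ring
  simp only [contractTorsion, h, ← Finset.mul_sum, Finset.sum_add_distrib, sum_sum_phi0,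
    ← EuclideanSpace.real_norm_sq_eq, mul_ite, mul_one, mul_zero, Finset.sum_ite_eq,
    Finset.mem_univ, if_true]
  field_simp
  ring

/-- Away from the origin the soliton equation is a scalar equation. -/
theorem solitonAt_iff {a f : ℝ → ℝ} (ha : ContDiff ℝ ∞ a) (hf : ContDiff ℝ ∞ f)
    (haf : ∀ r, f r ^ 2 + a r ^ 2 = 1) (c : ℝ) {x : E7} (hx : x ≠ 0) :
    SolitonAt c a f x ↔ radialDefect c a f ‖x‖ = 0 := by
  have key : ∀ q, divTorsion (fun y => f ‖y‖) (radialField a) q x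
      - contractTorsion (radialField fun r => c * r) (fun y => f ‖y‖) (radialField a) q x
      = -2 * radialDefect c a f ‖x‖ * x q := by
    intro q
    rw [divTorsion_radial ha hf haf hx, contractTorsion_radial ha hf haf c hx, radialDefect]
    ring
  constructor
  · intro h
    obtain ⟨q, hq⟩ : ∃ q, x q ≠ 0 := by
      by_contra! h0
      exact hx (PiLp.ext h0)
    have := key q
    rw [h q, sub_self] at this
    simpa [hq] using this.symm
  · intro h q
    have := key q
    rw [h] at this
    linarith

lemma _root_.Function.Even.deriv_zero {f : ℝ → ℝ} (hf : f.Even) : deriv f 0 = 0 := by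
  have h := deriv_comp_neg f 0
  rw [funext hf, neg_zero] at h
  linarith

lemma _root_.Function.Odd.even_deriv {a : ℝ → ℝ} (ha : a.Odd) : (deriv a).Even := by
  intro r
  have h := deriv_comp_neg a r
  rw [funext ha, deriv.fun_neg] at h
  linarith

/-- For a smooth odd function `a`, the even function `a(r) / r` is stationary at `0`. -/
lemma hasDerivAt_dslope_zero {a : ℝ → ℝ} (ha : ContDiff ℝ ∞ a) (ha_odd : a.Odd) :
    HasDerivAt (dslope a 0) 0 0 := by
  have h2 : ContDiff ℝ (2 : ℕ) a := contDiff_infty.1 ha 2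
  have h := taylor_isLittleO_univ (x₀ := 0) h2
  have e : ∀ r, a r - taylorWithinEval a 2 Set.univ 0 r = r * (dslope a 0 r - deriv a 0) := by
    intro r
    rw [taylorWithinEval_succ, taylorWithinEval_succ, taylor_within_zero_eval]
    rcases eq_or_ne r 0 with rfl | hr
    · simp
    · simp [iteratedDerivWithin_univ, iteratedDeriv_succ, iteratedDeriv_zero,
        ha_odd.even_deriv.deriv_zero, ha_odd.map_zero, dslope_of_ne a hr, slope_def_field]
      field_simp
  rw [hasDerivAt_iff_isLittleO]
  simp only [e, sub_zero, smul_zero, dslope_same] at h ⊢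
  rw [Asymptotics.isLittleO_iff] at h ⊢
  intro ε hε
  filter_upwards [h hε] with r hr
  rcases eq_or_ne r 0 with rfl | hr0
  · simp [dslope_same]
  · rw [norm_mul, norm_pow, sq, ← mul_assoc, mul_comm ‖r‖, mul_comm (ε * ‖r‖)] at hr
    have hp : 0 < ‖r‖ := norm_pos_iff.2 hr0
    nlinarith

lemma hasFDerivAt_radial_zero {s : ℝ → ℝ} (hs : HasDerivAt s 0 0) :
    HasFDerivAt (fun y : E7 => s ‖y‖) (0 : E7 →L[ℝ] ℝ) 0 := by
  rw [hasFDerivAt_iff_isLittleO]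
  rw [hasDerivAt_iff_isLittleO] at hs
  have ht : Tendsto (fun y : E7 => ‖y‖) (𝓝 0) (𝓝 0) := by
    simpa using (continuous_norm (E := E7)).tendsto 0
  refine Asymptotics.IsLittleO.of_norm_right ?_
  simpa [Function.comp_def] using hs.comp_tendsto ht

/-- The function `s(r) xᵢxⱼ / r²` is differentiable at the origin if `s(r) = o(r)`. -/
lemma differentiableAt_zero_of_radial {s : ℝ → ℝ} (h0 : s 0 = 0) (hs : HasDerivAt s 0 0)
    (i j : Fin 7) :
    DifferentiableAt ℝ (fun y : E7 => s ‖y‖ / ‖y‖ ^ 2 * (y i * y j)) 0 := by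
  have h := (hasFDerivAt_radial_zero hs).isLittleO
  refine HasFDerivAt.differentiableAt (f' := (0 : E7 →L[ℝ] ℝ)) ?_
  rw [hasFDerivAt_iff_isLittleO]
  refine Asymptotics.IsBigO.trans_isLittleO (Asymptotics.IsBigO.of_bound 1 ?_) h
  refine Eventually.of_forall fun y => ?_
  have hi := PiLp.norm_apply_le y i
  have hj := PiLp.norm_apply_le y j
  rcases eq_or_ne y 0 with rfl | hy
  · simp
  · have hp : 0 < ‖y‖ := norm_pos_iff.2 hy
    have hm : ‖y i‖ * ‖y j‖ ≤ ‖y‖ ^ 2 := by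
      rw [sq]
      gcongr
    simp only [PiLp.zero_apply, mul_zero, norm_zero, sub_zero, zero_apply, h0, one_mul, norm_mul,
      norm_div, norm_pow, norm_norm]
    rw [div_mul_eq_mul_div, div_le_iff₀ (by positivity)]
    gcongr

lemma radialField_eq_dslope {a : ℝ → ℝ} (ha : a 0 = 0) (x : E7) (i : Fin 7) :
    radialField a x i = dslope a 0 ‖x‖ * x i := by
  rcases eq_or_ne x 0 with rfl | hx
  · simp [radialField]
  · rw [radialField_apply, dslope_of_ne a (norm_ne_zero_iff.2 hx), slope_def_field, ha, sub_zero,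
      sub_zero]

/-- The torsion of `φ(f(r), a(r) ∂/∂r)` in a form that is valid on the whole space. -/
theorem torsion_radial_eq {a f : ℝ → ℝ} (ha : ContDiff ℝ ∞ a) (ha_odd : a.Odd)
    (hf : ContDiff ℝ ∞ f) (hf_even : f.Even) (haf : ∀ r, f r ^ 2 + a r ^ 2 = 1) (p q : Fin 7)
    (x : E7) :
    torsion (fun y => f ‖y‖) (radialField a) p q x
      = -2 * (f ‖x‖ * dslope a 0 ‖x‖ * (if q = p then 1 else 0)
        + (wronskian a f ‖x‖ - f ‖x‖ * dslope a 0 ‖x‖) / ‖x‖ ^ 2 * (x p * x q)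
        + dslope a 0 ‖x‖ ^ 2 * ∑ m, x m * phi0 m q p) := by
  have da : Differentiable ℝ a := ha.differentiable (by simp)
  have df : Differentiable ℝ f := hf.differentiable (by simp)
  rcases eq_or_ne x 0 with rfl | hx
  · have hf0 : HasDerivAt f 0 0 := by
      simpa [hf_even.deriv_zero] using (df 0).hasDerivAt
    have hf1 := hasFDerivAt_radial_zero hf0
    have hs := hasFDerivAt_radial_zero (hasDerivAt_dslope_zero ha ha_odd)
    have hX : ∀ m, DifferentiableAt ℝ (fun y => radialField a y m) 0 := fun m => by
      simp only [radialField_eq_dslope ha_odd.map_zero]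
      exact hs.differentiableAt.mul (by fun_prop)
    have hpf : partialD p (fun y => f ‖y‖) 0 = 0 := by
      rw [partialD, hf1.fderiv]
      rfl
    have hpX : ∀ m, partialD p (fun y => radialField a y m) 0
        = dslope a 0 0 * if m = p then 1 else 0 := fun m => by
      refine partialD_eq (hX m) ?_
      simp only [radialField_eq_dslope ha_odd.map_zero]
      refine ((hasDerivAt_partialD hs.differentiableAt p).mul
        (hasDerivAt_coordLine_apply 0 p m 0)).congr_deriv ?_
      simp [coordLine_zero]
    rw [torsion_eq hf1.differentiableAt hX (by simpa [radialField, ha_odd.map_zero] using haf 0),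
      hpf, hpX]
    simp [radialField]
  · rw [torsion_radial hx (da _) (df _) (haf _), dslope_of_ne a (norm_ne_zero_iff.2 hx),
      slope_def_field, ha_odd.map_zero, sub_zero, sub_zero, mul_div_assoc]

/-- The torsion is differentiable at the origin. -/
lemma differentiableAt_torsion_zero {a f : ℝ → ℝ} (ha : ContDiff ℝ ∞ a) (ha_odd : a.Odd)
    (hf : ContDiff ℝ ∞ f) (hf_even : f.Even) (haf : ∀ r, f r ^ 2 + a r ^ 2 = 1) (p q : Fin 7) :
    DifferentiableAt ℝ (torsion (fun y => f ‖y‖) (radialField a) p q) 0 := by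
  rw [funext (torsion_radial_eq ha ha_odd hf hf_even haf p q)]
  have hf0 : HasDerivAt f 0 0 := by
    simpa [hf_even.deriv_zero] using (hf.differentiable (by simp) 0).hasDerivAt
  have hs := hasDerivAt_dslope_zero ha ha_odd
  have hα : HasDerivAt (fun r => f r * dslope a 0 r) 0 0 := by
    simpa using hf0.fun_mul hs
  have hw : HasDerivAt (wronskian a f) 0 0 := by
    simpa [ha_odd.even_deriv.deriv_zero, ha_odd.map_zero] using hasDerivAt_wronskian ha hf 0
  have hβ : HasDerivAt (fun r => wronskian a f r - f r * dslope a 0 r) 0 0 := by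
    simpa using hw.fun_sub hα
  refine ((((hasFDerivAt_radial_zero hα).differentiableAt.mul_const _).add
    (differentiableAt_zero_of_radial ?_ hβ p q)).add
    (((hasFDerivAt_radial_zero hs).differentiableAt.pow 2).mul (by fun_prop))).const_mul _
  simp [wronskian, ha_odd.map_zero]

/-- A directional derivative at the origin vanishes if the function is even on the line. -/
lemma partialD_zero_of_even {F : E7 → ℝ} {p : Fin 7} (hF : DifferentiableAt ℝ F 0)
    (h : ∀ t : ℝ, F (coordLine 0 p (-t)) = F (coordLine 0 p t)) : partialD p F 0 = 0 := by
  have h1 := (hasDerivAt_partialD hF p).deriv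
  rw [← h1]
  exact Function.Even.deriv_zero h

/-- At the origin the soliton equation always holds. -/
theorem solitonAt_zero {a f : ℝ → ℝ} (ha : ContDiff ℝ ∞ a) (ha_odd : a.Odd)
    (hf : ContDiff ℝ ∞ f) (hf_even : f.Even) (haf : ∀ r, f r ^ 2 + a r ^ 2 = 1) (c : ℝ) :
    SolitonAt c a f 0 := by
  intro q
  have h1 : contractTorsion (radialField fun r => c * r) (fun y => f ‖y‖) (radialField a) q 0
      = 0 := by
    simp [contractTorsion, radialField]
  rw [h1, divTorsion]
  refine Finset.sum_eq_zero fun p _ => partialD_zero_of_even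
    (differentiableAt_torsion_zero ha ha_odd hf hf_even haf p q) fun t => ?_
  simp only [torsion_radial_eq ha ha_odd hf hf_even haf]
  simp [coordLine, norm_smul, phi0_eq_zero_outer]
  split_ifs <;> simp

lemma radialODE_iff {a f : ℝ → ℝ} (ha : ContDiff ℝ ∞ a) (hf : ContDiff ℝ ∞ f)
    (haf : ∀ r, f r ^ 2 + a r ^ 2 = 1) (c : ℝ) {r : ℝ} (hr : r ≠ 0) (hfr : f r ≠ 0) :
    RadialODE c a f r ↔ radialDefect c a f r = 0 := by
  have da : HasDerivAt a (deriv a r) r := (ha.differentiable (by simp) r).hasDerivAt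
  have df : HasDerivAt f (deriv f r) r := (hf.differentiable (by simp) r).hasDerivAt
  have h0 : f r * deriv f r + a r * deriv a r = 0 := by
    have h := (df.pow 2).add (da.pow 2)
    have h' : HasDerivAt (f ^ 2 + a ^ 2) 0 r := by
      have e : f ^ 2 + a ^ 2 = fun _ => 1 := funext haf
      rw [e]
      exact hasDerivAt_const r 1
    have := h.unique h'
    simp only [Nat.cast_ofNat, Nat.add_one_sub_one, pow_one] at this
    linarith
  have hw : deriv a r / f r = wronskian a f r := by
    rw [div_eq_iff hfr, wronskian]
    linear_combination (-deriv a r) * haf r + a r * h0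
  have e : 1 / r * (a r * deriv (deriv f) r - deriv (deriv a) r * f r)
      + 6 / r ^ 2 * (a r * deriv f r - deriv a r * f r) + 6 / r ^ 3 * (a r * f r)
      - -c * (deriv a r / f r) = -radialDefect c a f r := by
    rw [hw, radialDefect, wronskian]
    field_simp
    ring
  rw [RadialODE, ← sub_eq_zero, e, neg_eq_zero]

/-- The zeros of `f` impose no condition. -/
lemma radialDefect_eq_zero {a f : ℝ → ℝ} (ha : ContDiff ℝ ∞ a) (hf : ContDiff ℝ ∞ f) {c : ℝ}
    (h : ∀ r, 0 < r → f r ≠ 0 → radialDefect c a f r = 0) {r : ℝ} (hr : 0 < r) :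
    radialDefect c a f r = 0 := by
  by_contra hne
  have hc : ContinuousAt (radialDefect c a f) r := by
    have ca := ha.continuous
    have cf := hf.continuous
    have ca' := (ha.deriv' (n := ∞)).continuous
    have cf' := (hf.deriv' (n := ∞)).continuous
    have ca'' := ((ha.deriv' (n := ∞)).deriv' (n := ∞)).continuous
    have cf'' := ((hf.deriv' (n := ∞)).deriv' (n := ∞)).continuous
    have hr' := hr.ne'
    have hr2 := pow_ne_zero 2 hr'
    unfold radialDefect wronskian
    fun_prop (disch := assumption)
  have h0 : f =ᶠ[𝓝 r] fun _ => 0 := by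
    filter_upwards [hc.eventually_ne hne, eventually_gt_nhds hr] with s hs hs0
    by_contra hfs
    exact hs (h s hs0 hfs)
  have h1 : deriv f r = 0 := by rw [h0.deriv_eq, deriv_const]
  have h2 : deriv (deriv f) r = 0 := by
    rw [h0.deriv.deriv_eq]
    simp
  exact hne (by simp [radialDefect, wronskian, h0.eq_of_nhds, h1, h2])

lemma sineODE_iff {a f u : ℝ → ℝ} (hu : ContDiff ℝ ∞ u) (hau : ∀ r, a r = Real.sin (u r / 2))
    (hfu : ∀ r, f r = Real.cos (u r / 2)) (ha : ContDiff ℝ ∞ a) (hf : ContDiff ℝ ∞ f) (c : ℝ)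
    {r : ℝ} (hr : r ≠ 0) : SineODE c u r ↔ radialDefect c a f r = 0 := by
  have du : ∀ s, HasDerivAt u (deriv u s) s := fun s =>
    (hu.differentiable (by simp) s).hasDerivAt
  have da : ∀ s, deriv a s = Real.cos (u s / 2) * (deriv u s / 2) := fun s => by
    rw [funext hau]
    exact ((du s).div_const 2).sin.deriv
  have df : ∀ s, deriv f s = -Real.sin (u s / 2) * (deriv u s / 2) := fun s => by
    rw [funext hfu]
    exact ((du s).div_const 2).cos.deriv
  have hw : ∀ s, wronskian a f s = deriv u s / 2 := fun s => by
    rw [wronskian, da, df, hau, hfu]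
    linear_combination (deriv u s / 2) * Real.sin_sq_add_cos_sq (u s / 2)
  have hw' : f r * deriv (deriv a) r - deriv (deriv f) r * a r = deriv (deriv u) r / 2 := by
    rw [← (hasDerivAt_wronskian ha hf r).deriv, funext hw, deriv_div_const]
  have hs : f r * a r = Real.sin (u r) / 2 := by
    rw [hau, hfu]
    have := Real.sin_two_mul (u r / 2)
    rw [mul_div_cancel₀ _ two_ne_zero] at this
    linarith
  have e : radialDefect c a f r = (r ^ 2 * deriv (deriv u) r
      + (6 - c * r ^ 2) * r * deriv u r - 6 * Real.sin (u r)) / (2 * r ^ 3) := by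
    rw [radialDefect, hw', hw, hs]
    field_simp
    ring
  rw [e, SineODE, div_eq_zero_iff]
  simp [hr]

lemma exists_norm_eq_of_pos {r : ℝ} (hr : 0 < r) : ∃ x : E7, x ≠ 0 ∧ ‖x‖ = r :=
  ⟨EuclideanSpace.single 0 r, by simpa using hr.ne', by simp [hr.le]⟩

lemma forall_solitonAt_iff {a f : ℝ → ℝ} (ha : ContDiff ℝ ∞ a) (ha_odd : a.Odd)
    (hf : ContDiff ℝ ∞ f) (hf_even : f.Even) (haf : ∀ r, f r ^ 2 + a r ^ 2 = 1) (c : ℝ) :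
    (∀ x, SolitonAt c a f x) ↔ ∀ r, 0 < r → radialDefect c a f r = 0 := by
  constructor
  · intro h r hr
    obtain ⟨x, hx, rfl⟩ := exists_norm_eq_of_pos hr
    exact (solitonAt_iff ha hf haf c hx).1 (h x)
  · intro h x
    rcases eq_or_ne x 0 with rfl | hx
    · exact solitonAt_zero ha ha_odd hf hf_even haf c
    · exact (solitonAt_iff ha hf haf c hx).2 (h _ (norm_pos_iff.2 hx))

end IsometricSoliton

end

open IsometricSoliton in
theorem proposition3p2 (c : ℝ) (a f : ℝ → ℝ)
    (ha : ContDiff ℝ ∞ a) (ha_odd : a.Odd)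
    (hf : ContDiff ℝ ∞ f) (hf_even : f.Even)
    (haf : ∀ r, f r ^ 2 + a r ^ 2 = 1) :
    -- the soliton equation on all of `ℝ⁷` is equivalent to the equation for `a` and `f`
    ((∀ x, IsometricSoliton.SolitonAt c a f x) ↔
      ∀ r, 0 < r → f r ≠ 0 → IsometricSoliton.RadialODE c a f r) ∧
    -- and the two are equivalent point by point
    (∀ x, x ≠ 0 → f ‖x‖ ≠ 0 →
      (IsometricSoliton.SolitonAt c a f x ↔ IsometricSoliton.RadialODE c a f ‖x‖)) ∧
    -- the same for the equation for `u`, when `a = sin (u / 2)` and `f = cos (u / 2)`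
    (∀ u : ℝ → ℝ, ContDiff ℝ ∞ u →
      (∀ r, a r = Real.sin (u r / 2)) → (∀ r, f r = Real.cos (u r / 2)) →
      ((∀ x, IsometricSoliton.SolitonAt c a f x) ↔
        ∀ r, 0 < r → IsometricSoliton.SineODE c u r) ∧
      (∀ x, x ≠ 0 →
        (IsometricSoliton.SolitonAt c a f x ↔ IsometricSoliton.SineODE c u ‖x‖))) := by
  refine ⟨?_, ?_, ?_⟩
  · rw [forall_solitonAt_iff ha ha_odd hf hf_even haf]
    constructor
    · intro h r hr hfr
      exact (radialODE_iff ha hf haf c hr.ne' hfr).2 (h r hr)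
    · intro h r hr
      exact radialDefect_eq_zero ha hf
        (fun s hs hfs => (radialODE_iff ha hf haf c hs.ne' hfs).1 (h s hs hfs)) hr
  · intro x hx hfx
    rw [solitonAt_iff ha hf haf c hx, radialODE_iff ha hf haf c (norm_ne_zero_iff.2 hx) hfx]
  · intro u hu hau hfu
    refine ⟨?_, fun x hx => ?_⟩
    · rw [forall_solitonAt_iff ha ha_odd hf hf_even haf]
      exact forall₂_congr fun r hr => (sineODE_iff hu hau hfu ha hf c hr.ne').symm
    · rw [solitonAt_iff ha hf haf c hx, sineODE_iff hu hau hfu ha hf c (norm_ne_zero_iff.2 hx)]
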